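/- **Setting.** A *represented space* is a set $X$ with a partial surjection $\delta_X:\subseteq\mathbb N^{\mathbb N}\to X$; if $\delta_X(p)=x$, then $p$ is a *name* of $x$. A *realizer* of a partial map $f:\subseteq X\to Y$ between represented spaces is a partial function $F:\subseteq\mathbb N^{\mathbb N}\to\mathbb N^{\mathbb N}$ with $\delta_Y(F(p))=f(\delta_X(p))$ for all $p\in\operatorname{dom}(f\circ\delta_X)$. The map $f$ is *computable* (*continuous*) if it has a computable (continuous) realizer. Products are represented by $\delta_{X\times Y}(\langle p,q\rangle)=(\delta_X(p),\delta_Y(q))$, where $\langle p,q\rangle(2n)=p(n)$ and $\langle p,q\rangle(2n+1)=q(n)$. The space $\mathcal C(\mathbf X,\mathbf Y)$ consists of the continuous total maps $f$ from $\mathbf X$ to $\mathbf Y$; the sequence $nq$ (the number $n$ followed by $q\in\mathbb N^{\mathbb N}$) is a name of $f$ iff the $n$-th machine with oracle $q$ computes a realizer of $f$. For $k\ge 1$ let $\mathbf k_\bot$ be the space with elements $0,\dots,k-1,\bot$, where $0^\omega$ is the only name of $\bot$ and the names of $\ell<k$ are the sequences $0^m1^{\ell+1}0^\omega$ with $m\in\mathbb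 N$. Elements of $\mathbb R_>$ are the reals, named by (non-strictly) decreasing sequences of rationals converging to them. $\overline{\mathbb R}_>$ is the analogous space of extended reals, named by decreasing sequences in $\mathbb Q\cup\{+\infty\}$ converging to them. A *computable metric space* is a metric space $(X,d)$ with a dense sequence $(a_i)_{i\in\mathbb N}$ such that $(i,j)\mapsto d(a_i,a_j)$ is a computable double sequence of reals; $p$ is a name of $x$ iff $d(a_{p(n)},x)\le 2^{-n}$ for all $n$. $B(x,r)$ denotes the open ball. **Proposition 3.6.** Let $\mathbf X$ be a computable metric space with metric $d$, and let $k\ge 1$. For $x\in X$ and $f\in\mathcal C(\mathbf X,\mathbf k_\bot)$ put $$R(x,f)=\{r\in\mathbb R : r\ge 0,\ \exists y\in B(x,r)\ \ \bot\ne f(x)\ne f(y)\ne\bot\}.$$ Then the map $$(x,f)\mapsto\inf R(x,f):\ \mathbf X\times\mathcal C(\mathbf X,\mathbf k_\bot)\to\overline{\mathbb R}_>,$$ where $\inf\emptyset=+\infty$, is computable. Moreover, the partial map $$(x,f)\mapsto\inf R(x,f):\ \subseteq\mathbf X\times\mathcal C(\mathbf X,\mathbf k_\bot)\to\mathbb R_>,$$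 whose domain consists of the $(x,f)$ with $R(x,f)\ne\emptyset$, is computable. -/

import Mathlib

/-! ## Type-2 machines -/

namespace TypeTwo

/-- The pairing `⟨p, q⟩(2n) = p(n)`, `⟨p, q⟩(2n+1) = q(n)` of Baire space. -/
def join (p q : ℕ → ℕ) : ℕ → ℕ := fun n => if n % 2 = 0 then p (n / 2) else q (n / 2)

/-- The sequence `n q`, which starts with `n` and continues with `q`. -/
def cons (n : ℕ) (q : ℕ → ℕ) : ℕ → ℕ
  | 0 => n
  | i + 1 => q i

/-- What the machine with program `e` does on input `m` after it has read exactly the first `s`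
symbols of the oracle tape `p`, as an ordinary (possibly divergent) computation of the
program `e`: the result `0` is a request to read the next oracle symbol, the result `v + 1`
means that the machine halts with output `v`. -/
def step (e : Nat.Partrec.Code) (p : ℕ → ℕ) (m s : ℕ) : Part ℕ :=
  e.eval (Encodable.encode ((List.range s).map p, m))

/-- The output of the machine with program `e` and oracle tape `p` on input `m`. The machine
reads the oracle tape from left to right, and halts at the first stage `s` at which it does
not ask for another symbol. Everything else is divergence. -/
def run (e : Nat.Partrec.Code) (p : ℕ → ℕ) (m : ℕ) : Part ℕ :=
  (Nat.rfind fun s => (step e p m s).map fun v => decide (v ≠ 0)).bind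
    fun s => (step e p m s).map Nat.pred

/-- The partial function `F :⊆ ℕ^ℕ → ℕ^ℕ` computed by the program `e`: `F(p)(m)` is the output on
input `m` with oracle tape `p`, and `F(p)` is defined iff all of these outputs are. -/
def machine (e : Nat.Partrec.Code) : (ℕ → ℕ) →. (ℕ → ℕ) := fun p =>
  ⟨∀ m, (run e p m).Dom, fun h m => (run e p m).get (h m)⟩

/-- The `n`-th program, in the standard numbering of programs. -/
def program (n : ℕ) : Nat.Partrec.Code := Denumerable.ofNat Nat.Partrec.Code n

/-- The partial function computed by the `n`-th machine with fixed oracle `q`; it sends `p` to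
what the machine produces from `⟨q, p⟩`. -/
def machineWithOracle (n : ℕ) (q : ℕ → ℕ) : (ℕ → ℕ) →. (ℕ → ℕ) := fun p =>
  machine (program n) (join q p)

/-- A partial function on Baire space is computable if some machine computes it, at least
on its domain. -/
def IsComputable (F : (ℕ → ℕ) →. (ℕ → ℕ)) : Prop :=
  ∃ n : ℕ, ∀ p r, r ∈ F p → r ∈ machine (program n) p

/-- Continuity of a partial function on Baire space, that is, on the subspace `dom F`. -/
def IsContinuous (F : (ℕ → ℕ) →. (ℕ → ℕ)) : Prop :=
  Continuous fun p : F.Dom => F.fn p.1 p.2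

end TypeTwo

/-! ## Represented spaces -/

/-- A represented space on the set `X`: a partial surjection `δ :⊆ ℕ^ℕ → X`, given by its graph
`IsName p x`, i.e. `δ(p) = x`. -/
structure RepresentedSpace (X : Type*) where
  IsName : (ℕ → ℕ) → X → Prop
  unique : ∀ {p x y}, IsName p x → IsName p y → x = y
  surjective : ∀ x, ∃ p, IsName p x

namespace RepresentedSpace

open TypeTwo

variable {X Y : Type*}

/-- `F` is a realizer of the partial map `f :⊆ X → Y`:
`δ_Y(F(p)) = f(δ_X(p))` for all `p ∈ dom(f δ_X)`. -/
def Realizes (A : RepresentedSpace X) (B : RepresentedSpace Y)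
    (F : (ℕ → ℕ) →. (ℕ → ℕ)) (f : X →. Y) : Prop :=
  ∀ p x y, A.IsName p x → y ∈ f x → ∃ r ∈ F p, B.IsName r y

/-- A partial map between represented spaces is computable if it has a computable realizer. -/
def IsComputableMap (A : RepresentedSpace X) (B : RepresentedSpace Y) (f : X →. Y) : Prop :=
  ∃ F, TypeTwo.IsComputable F ∧ Realizes A B F f

/-- A partial map between represented spaces is continuous if it has a continuous realizer. -/
def IsContinuousMap (A : RepresentedSpace X) (B : RepresentedSpace Y) (f : X →. Y) : Prop :=
  ∃ F, TypeTwo.IsContinuous F ∧ Realizes A B F f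

/-- The product of two represented spaces. -/
def prod (A : RepresentedSpace X) (B : RepresentedSpace Y) : RepresentedSpace (X × Y) where
  IsName p z := ∃ u v, p = join u v ∧ A.IsName u z.1 ∧ B.IsName v z.2
  unique := by
    rintro p ⟨x, y⟩ ⟨x', y'⟩ ⟨u, v, rfl, hu, hv⟩ ⟨u', v', h, hu', hv'⟩
    have h1 : u = u' := by
      funext n
      have := congrFun h (2 * n)
      simpa [join] using this
    have h2 : v = v' := by
      funext n
      have := congrFun h (2 * n + 1)
      have e : (2 * n + 1) / 2 = n := by omega
      simpa [join, e, Nat.add_mod] using this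
    subst h1 h2
    exact Prod.ext (A.unique hu hu') (B.unique hv hv')
  surjective := by
    rintro ⟨x, y⟩
    obtain ⟨u, hu⟩ := A.surjective x
    obtain ⟨v, hv⟩ := B.surjective y
    exact ⟨join u v, u, v, rfl, hu, hv⟩

/-- The set underlying `𝒞(A, B)`: the (total) continuous maps from `A` to `B`. -/
def Maps (A : RepresentedSpace X) (B : RepresentedSpace Y) : Type _ :=
  {f : X → Y // IsContinuousMap A B (f : X →. Y)}

end RepresentedSpace

namespace TypeTwo

/-! Every continuous function on Baire space is, on its domain, computed by a machine
with an oracle. -/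

/-- The symbols at the odd positions of a list, at most `t` of them. -/
def oddPart (l : List ℕ) (t : ℕ) : List ℕ :=
  (List.range (min t (l.length / 2))).map fun i => l.getD (2 * i + 1) 0

/-- The program which uses `q` in the oracle `⟨q, p⟩` as a table that maps a prefix of `p` and an
argument to `0` (no answer) or to the value plus one. -/
def lookup (x : List ℕ × ℕ) : ℕ :=
  x.1.getD (2 * Encodable.encode (oddPart x.1 x.1.length.unpair.1, x.2)) 0

theorem lookup_primrec : Primrec lookup := by
  have hodd : Primrec₂ oddPart := by
    refine Primrec.list_map (f := fun x : List ℕ × ℕ => List.range (min x.2 (x.1.length / 2)))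
      (g := fun x i => x.1.getD (2 * i + 1) 0) ?_ ?_
    · exact Primrec.list_range.comp (Primrec.nat_min.comp Primrec.snd
        (Primrec.nat_div.comp (Primrec.list_length.comp Primrec.fst) (Primrec.const 2)))
    · exact (Primrec.list_getD 0).comp (Primrec.fst.comp Primrec.fst)
        (Primrec.succ.comp (Primrec.nat_mul.comp (Primrec.const 2) Primrec.snd))
  exact (Primrec.list_getD 0).comp Primrec.fst (Primrec.nat_mul.comp (Primrec.const 2)
    (Primrec.encode.comp (Primrec.pair (hodd.comp Primrec.fst (Primrec.fst.comp
      (Primrec.unpair.comp (Primrec.list_length.comp Primrec.fst)))) Primrec.snd)))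

theorem lookup_join (q p : ℕ → ℕ) (m s : ℕ) :
    lookup ((List.range s).map (join q p), m) =
      if 2 * Encodable.encode ((List.range (min s.unpair.1 (s / 2))).map p, m) < s then
        q (Encodable.encode ((List.range (min s.unpair.1 (s / 2))).map p, m)) else 0 := by
  have h : oddPart ((List.range s).map (join q p)) s.unpair.1 =
      (List.range (min s.unpair.1 (s / 2))).map p := by
    unfold oddPart
    rw [List.length_map, List.length_range]
    refine List.map_congr_left fun i hi => ?_
    have hi' : 2 * i + 1 < s := by
      have := List.mem_range.1 hi
      omega
    have e : (2 * i + 1) / 2 = i := by omega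
    simp [List.getD, hi', join, e, Nat.add_mod]
  simp only [lookup, List.length_map, List.length_range, h]
  generalize Encodable.encode ((List.range (min s.unpair.1 (s / 2))).map p, m) = c
  split_ifs with hs
  · simp [List.getD, hs, join]
  · simp [List.getD, hs]

theorem exists_oracle (F : (ℕ → ℕ) →. (ℕ → ℕ)) (hF : IsContinuous F) :
    ∃ n q, ∀ p r, r ∈ F p → r ∈ machineWithOracle n q p := by
  classical
  let good (l : List ℕ) (m v : ℕ) : Prop :=
    ∀ p r, r ∈ F p → (List.range l.length).map p = l → r m = v
  let tbl (x : List ℕ × ℕ) : ℕ := if h : ∃ v, good x.1 x.2 v then h.choose + 1 else 0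
  let q : ℕ → ℕ := fun k => ((Encodable.decode (α := List ℕ × ℕ) k).map tbl).getD 0
  have hq : ∀ x, q (Encodable.encode x) = tbl x := fun x => by
    simp only [q, Encodable.encodek, Option.map_some, Option.getD_some]
  have hP : Nat.Partrec fun k =>
      Part.bind (Encodable.decode (α := List ℕ × ℕ) k) fun a =>
        ((fun a => Part.some (lookup a) : List ℕ × ℕ →. ℕ) a).map Encodable.encode :=
    lookup_primrec.to_comp
  obtain ⟨e, he⟩ := Nat.Partrec.Code.exists_code.1 hP
  refine ⟨Encodable.encode e, q, fun p r hr => ?_⟩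
  have hprog : program (Encodable.encode e) = e := by simp [program]
  have hstep : ∀ m s, step e (join q p) m s =
      Part.some (lookup ((List.range s).map (join q p), m)) := by
    intro m s
    simp [step, he]
  have hsound : ∀ m s, lookup ((List.range s).map (join q p), m) ≠ 0 →
      lookup ((List.range s).map (join q p), m) = r m + 1 := by
    intro m s hs
    rw [lookup_join] at hs ⊢
    split_ifs at hs ⊢ with h1
    · rw [hq] at hs ⊢
      simp only [tbl] at hs ⊢
      split_ifs at hs ⊢ with h2
      · have := h2.choose_spec p r hr (by simp)
        omega
      · exact absurd rfl hs
    · exact absurd rfl hs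
  have hex : ∀ m, ∃ s, lookup ((List.range s).map (join q p), m) ≠ 0 := by
    intro m
    obtain ⟨t, ht⟩ : ∃ t, good ((List.range t).map p) m (r m) := by
      have hd : p ∈ F.Dom := Part.dom_iff_mem.2 ⟨r, hr⟩
      have hrp : F.fn p hd = r := Part.get_eq_of_mem hr _
      have hc : Continuous fun z : F.Dom => F.fn z.1 z.2 m :=
        (continuous_apply m).comp hF
      have ho : IsOpen ((fun z : F.Dom => F.fn z.1 z.2 m) ⁻¹' {r m}) :=
        (isOpen_discrete _).preimage hc
      obtain ⟨U, hU, hUe⟩ := isOpen_induced_iff.1 ho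
      have hpU : p ∈ U := by
        have : (⟨p, hd⟩ : F.Dom) ∈ Subtype.val ⁻¹' U := by
          rw [hUe]
          exact congrFun hrp m
        exact this
      obtain ⟨I, u, hu, hIU⟩ := isOpen_pi_iff.1 hU p hpU
      refine ⟨I.sup id + 1, fun p' r' hr' hp' => ?_⟩
      have hd' : p' ∈ F.Dom := Part.dom_iff_mem.2 ⟨r', hr'⟩
      have hrp' : F.fn p' hd' = r' := Part.get_eq_of_mem hr' _
      have hagree : ∀ i ∈ I, p' i = p i := by
        intro i hi
        have hlt : i < I.sup id + 1 := Nat.lt_succ_of_le (Finset.le_sup (f := id) hi)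
        rw [List.length_map, List.length_range] at hp'
        exact List.map_inj_left.1 hp' i (List.mem_range.2 hlt)
      have hpU' : p' ∈ U := hIU fun i hi => by
        rw [hagree i hi]
        exact (hu i hi).2
      have : (⟨p', hd'⟩ : F.Dom) ∈ Subtype.val ⁻¹' U := hpU'
      rw [hUe] at this
      exact (congrFun hrp' m).symm.trans this
    set c := Encodable.encode ((List.range t).map p, m) with hc
    set s := Nat.pair t (2 * t + 2 * c + 1) with hs
    have hle : 2 * t + 2 * c + 1 ≤ s := Nat.right_le_pair _ _
    have hmin : min s.unpair.1 (s / 2) = t := by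
      rw [hs, Nat.unpair_pair, ← hs]
      simp only
      omega
    refine ⟨s, ?_⟩
    rw [lookup_join, hmin, if_pos (by omega), hq]
    have : ∃ v, good ((List.range t).map p) m v := ⟨_, ht⟩
    simp [tbl, this]
  have hrun : ∀ m, r m ∈ run e (join q p) m := by
    intro m
    refine Part.mem_bind_iff.2 ⟨Nat.find (hex m), ?_, ?_⟩
    · refine Nat.mem_rfind.2 ⟨?_, fun {s} hs => ?_⟩
      · have := Nat.find_spec (hex m)
        simp only [hstep, Part.map_some, Part.mem_some_iff]
        simpa using this
      · have := Nat.find_min (hex m) hs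
        simp only [hstep, Part.map_some, Part.mem_some_iff]
        simpa using this
    · rw [hstep, Part.map_some, Part.mem_some_iff,
        hsound m _ (Nat.find_spec (hex m)), Nat.pred_succ]
  have hdom : ∀ m, (run e (join q p) m).Dom := fun m => Part.dom_iff_mem.2 ⟨_, hrun m⟩
  unfold machineWithOracle
  rw [hprog]
  refine Part.mem_mk_iff.2 ⟨hdom, ?_⟩
  funext m
  exact Part.get_eq_of_mem (hrun m) _

end TypeTwo

namespace RepresentedSpace

open TypeTwo

variable {X Y : Type*}

/-- The function space `𝒞(A, B)`: the sequence `n q` is a name of `f` iff the `n`-th machine with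
oracle `q` computes a realizer of `f`. -/
def functionSpace (A : RepresentedSpace X) (B : RepresentedSpace Y) :
    RepresentedSpace (Maps A B) where
  IsName p f := ∃ n q, p = cons n q ∧
    Realizes A B (machineWithOracle n q) (f.1 : X →. Y)
  unique := by
    rintro p f g ⟨n, q, rfl, hf⟩ ⟨n', q', h, hg⟩
    have h1 : n = n' := congrFun h 0
    have h2 : q = q' := funext fun i => congrFun h (i + 1)
    subst h1 h2
    refine Subtype.ext (funext fun x => ?_)
    obtain ⟨p, hp⟩ := A.surjective x
    obtain ⟨r, hr, hrf⟩ := hf p x (f.1 x) hp (Part.mem_some _)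
    obtain ⟨r', hr', hrg⟩ := hg p x (g.1 x) hp (Part.mem_some _)
    have := Part.mem_unique hr hr'
    subst this
    exact B.unique hrf hrg
  surjective := by
    rintro ⟨f, F, hF, hFf⟩
    obtain ⟨n, q, h⟩ := exists_oracle F hF
    refine ⟨cons n q, n, q, rfl, fun p x y hp hy => ?_⟩
    obtain ⟨r, hr, hry⟩ := hFf p x y hp hy
    exact ⟨r, h p r hr, hry⟩

/-- The space `𝐤_⊥` of colours `0, …, k-1` together with `⊥` (here `none`): the only name of `⊥`
is `0^ω`, and the names of `ℓ` are the sequences `0^m 1^(ℓ+1) 0^ω`. -/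
def colours (k : ℕ) : RepresentedSpace (Option (Fin k)) where
  IsName p c := match c with
    | none => ∀ i, p i = 0
    | some l => ∃ m, ∀ i, p i = if m ≤ i ∧ i < m + (l.1 + 1) then 1 else 0
  unique := by
    have key : ∀ (p : ℕ → ℕ) (a b m m' : ℕ),
        (∀ i, p i = if m ≤ i ∧ i < m + (a + 1) then 1 else 0) →
        (∀ i, p i = if m' ≤ i ∧ i < m' + (b + 1) then 1 else 0) → a ≤ b := by
      intro p a b m m' h h'
      have e1 := h m
      have e2 := h (m + a)
      rw [if_pos (by omega)] at e1 e2
      rw [h'] at e1 e2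
      split_ifs at e1 e2
      omega
    rintro p (_ | a) (_ | b) h h'
    · rfl
    · obtain ⟨m, hm⟩ := h'
      have := hm m
      simp [h m] at this
    · obtain ⟨m, hm⟩ := h
      have := hm m
      simp [h' m] at this
    · obtain ⟨m, hm⟩ := h
      obtain ⟨m', hm'⟩ := h'
      exact congrArg some (Fin.ext (le_antisymm (key p _ _ _ _ hm hm') (key p _ _ _ _ hm' hm)))
  surjective := by
    rintro (_ | a)
    · exact ⟨fun _ => 0, fun _ => rfl⟩
    · exact ⟨_, 0, fun _ => rfl⟩

end RepresentedSpace

/-! ## Upper reals -/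

/-- The standard numbering of the rationals. -/
def ratOfNat (n : ℕ) : ℚ :=
  ((n.unpair.1.unpair.1 : ℚ) - n.unpair.1.unpair.2) / (n.unpair.2 + 1)

theorem ratOfNat_surjective : Function.Surjective ratOfNat := by
  intro q
  refine ⟨Nat.pair (Nat.pair q.num.toNat (-q.num).toNat) (q.den - 1), ?_⟩
  have h1 : ((q.num.toNat : ℤ) - ((-q.num).toNat : ℤ)) = q.num := by omega
  have h1' : ((q.num.toNat : ℚ) - ((-q.num).toNat : ℚ)) = q.num := by exact_mod_cast h1
  have h2 : ((q.den - 1 : ℕ) : ℚ) + 1 = q.den := by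
    have : q.den - 1 + 1 = q.den := Nat.sub_add_cancel q.pos
    exact_mod_cast this
  simp only [ratOfNat, Nat.unpair_pair]
  rw [h1', h2, Rat.num_div_den]

/-- The numbering of the rationals together with `+∞`, which is number `0`. -/
noncomputable def extRatOfNat : ℕ → EReal
  | 0 => ⊤
  | n + 1 => ((ratOfNat n : ℝ) : EReal)

/-- The space `ℝ_>`: a real is named by a decreasing sequence of rationals which converges to it. -/
def upperReal : RepresentedSpace ℝ where
  IsName p x := Antitone (fun n => (ratOfNat (p n) : ℝ)) ∧
    Filter.Tendsto (fun n => (ratOfNat (p n) : ℝ)) Filter.atTop (nhds x)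
  unique h h' := tendsto_nhds_unique h.2 h'.2
  surjective x := by
    obtain ⟨u, hu, -, hux⟩ := Real.exists_seq_rat_strictAnti_tendsto x
    choose p hp using fun n => ratOfNat_surjective (u n)
    refine ⟨p, ?_, ?_⟩
    · simp only [hp]
      exact Rat.cast_mono.comp_antitone hu.antitone
    · simpa only [hp] using hux

/-- The extended upper reals: an element is named by a decreasing sequence in `ℚ ∪ {+∞}` which
converges to it. -/
def extUpperReal : RepresentedSpace EReal where
  IsName p x := Antitone (fun n => extRatOfNat (p n)) ∧
    Filter.Tendsto (fun n => extRatOfNat (p n)) Filter.atTop (nhds x)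
  unique h h' := tendsto_nhds_unique h.2 h'.2
  surjective x := by
    rcases eq_or_ne x ⊤ with rfl | hx
    · refine ⟨fun _ => 0, fun _ _ _ => le_rfl, ?_⟩
      exact tendsto_const_nhds
    · obtain ⟨u, hu, -, hux⟩ := EReal.denseRange_ratCast.exists_seq_strictAnti_tendsto_of_lt
        (fun a b h => by exact_mod_cast h) (lt_top_iff_ne_top.2 hx)
      choose p hp using fun n => ratOfNat_surjective (u n)
      refine ⟨fun n => p n + 1, ?_, ?_⟩
      · intro m n hmn
        simp only [extRatOfNat, hp]
        exact_mod_cast hu.antitone hmn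
      · simp only [extRatOfNat, hp]
        exact hux

/-! ## Computable metric spaces -/

/-- The structure of a computable metric space on the metric space `X`: a dense sequence of points
`a₀, a₁, …` such that `(i, j) ↦ d(aᵢ, aⱼ)` is a computable double sequence of reals, i.e. a
computable function produces from `(i, j, n)` a rational `2^(-n)`-close to `d(aᵢ, aⱼ)`. -/
structure ComputableMetric (X : Type*) [MetricSpace X] where
  point : ℕ → X
  dense : DenseRange point
  dist_computable : ∃ g : ℕ × ℕ × ℕ → ℕ, Computable g ∧
    ∀ i j n, |(ratOfNat (g (i, j, n)) : ℝ) - dist (point i) (point j)| ≤ (1 / 2) ^ n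

namespace ComputableMetric

open RepresentedSpace

variable {X : Type*} [MetricSpace X]

/-- The represented space of a computable metric space: `p` is a name of `x` iff `d(a_{p(n)}, x)` is
at most `2^(-n)` for all `n`. -/
def space (M : ComputableMetric X) : RepresentedSpace X where
  IsName p x := ∀ n, dist (M.point (p n)) x ≤ (1 / 2) ^ n
  unique := by
    intro p x y hx hy
    have h0 : Filter.Tendsto (fun n : ℕ => ((1 : ℝ) / 2) ^ n) Filter.atTop (nhds 0) :=
      tendsto_pow_atTop_nhds_zero_of_lt_one (by norm_num) (by norm_num)
    have key : ∀ z, (∀ n, dist (M.point (p n)) z ≤ (1 / 2) ^ n) →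
        Filter.Tendsto (fun n => M.point (p n)) Filter.atTop (nhds z) := fun z hz =>
      tendsto_iff_dist_tendsto_zero.2
        (squeeze_zero (fun _ => dist_nonneg) hz h0)
    exact tendsto_nhds_unique (key x hx) (key y hy)
  surjective x := by
    have h : ∀ n : ℕ, ∃ i, dist (M.point i) x ≤ (1 / 2) ^ n := fun n => by
      obtain ⟨i, hi⟩ := M.dense.exists_dist_lt x (ε := (1 / 2) ^ n) (by positivity)
      exact ⟨i, by rw [dist_comm]; exact hi.le⟩
    choose p hp using h
    exact ⟨p, hp⟩

/-- The space `𝒞(A, 𝐤_⊥)` of classifiers with `k` colours, as a set. -/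
abbrev Classifier (M : ComputableMetric X) (k : ℕ) : Type _ := Maps M.space (colours k)

/-- The radii `r ≥ 0` such that `B(x, r)` contains a point `y` with `⊥ ≠ f(x) ≠ f(y) ≠ ⊥`. -/
def adversarialRadii {k : ℕ} (x : X) (f : X → Option (Fin k)) : Set ℝ :=
  {r | 0 ≤ r ∧ ∃ y ∈ Metric.ball x r, f x ≠ none ∧ f x ≠ f y ∧ f y ≠ none}

end ComputableMetric

namespace TypeTwo

open Encodable
open Nat.Partrec (Code)

/-! ### Machines: use principle, step-bounded simulation, construction from total functions -/

/-! The infimum of `R(x, f)` equals the infimum of `d(x, a_j)` over those points `a_j` of the dense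
sequence for which `f x` and `f (a_j)` are distinct colours. If `d(x, a_j) < r` for such a `j`, then
`r` lies in `R(x, f)`. Conversely, a witness `y` in the open ball `B(x, r)` can be moved to a dense
point with the same colour inside the ball, because `f` is locally constant where it is not `⊥`
(`eventually_eq_colour`, a consequence of the finite use of a halting computation).

The right-hand infimum can be approximated from above. A colour is recognised from finitely many
outputs: in a name `0^m 1^(l+1) 0^ω` the partial sums are constant up to `m`, then grow strictly
until they reach `l + 1`, so two equal nonzero consecutive sums certify the colour
(`colour_of_sum`), and every colour is eventually certified (`sum_of_colour`). Having distinct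
colours is therefore semidecidable (`separates_sound`, `separates_complete`). The distance from `x`
to `a_j` has computable upper bounds of arbitrary precision (`addSlack_bounds`). Running through all
points, summation lengths and fuels, and keeping the minimum of the bounds found so far, gives a
decreasing sequence with the required limit (`tendsto_bestBound`).

Stage `c` of this search depends only on the first `c` symbols of the input, so a machine can
evaluate it on the prefix read so far. For values in `ℝ_>` the machine also waits for the first
finite bound, which appears precisely because `R(x, f)` is nonempty. -/

theorem mem_run_iff {e : Code} {p : ℕ → ℕ} {m v : ℕ} :
    v ∈ run e p m ↔ ∃ s, v + 1 ∈ step e p m s ∧ ∀ s' < s, 0 ∈ step e p m s' := by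
  have key : ∀ b s, b ∈ (step e p m s).map (fun v => decide (v ≠ 0)) ↔
      ∃ w ∈ step e p m s, decide (w ≠ 0) = b := fun b s => Part.mem_map_iff _
  constructor
  · intro h
    obtain ⟨s, hs, h⟩ := Part.mem_bind_iff.1 h
    obtain ⟨hs, hlt⟩ := Nat.mem_rfind.1 hs
    obtain ⟨w, hw, hw0⟩ := (key _ _).1 hs
    obtain ⟨w', hw', rfl⟩ := (Part.mem_map_iff _).1 h
    obtain rfl := Part.mem_unique hw hw'
    refine ⟨s, ?_, fun s' hs' => ?_⟩
    · have hw0 : w ≠ 0 := by simpa using hw0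
      simpa [Nat.sub_add_cancel (Nat.pos_of_ne_zero hw0)] using hw
    · obtain ⟨z, hz, hz0⟩ := (key _ _).1 (hlt hs')
      have hz0 : z = 0 := by simpa using hz0
      exact hz0 ▸ hz
  · rintro ⟨s, hs, hlt⟩
    refine Part.mem_bind_iff.2 ⟨s, Nat.mem_rfind.2 ⟨?_, fun {s'} hs' => ?_⟩, ?_⟩
    · exact (key _ _).2 ⟨_, hs, by simp⟩
    · exact (key _ _).2 ⟨0, hlt s' hs', by simp⟩
    · exact (Part.mem_map_iff _).2 ⟨_, hs, rfl⟩

theorem step_congr {e : Code} {p p' : ℕ → ℕ} {m s : ℕ} (h : ∀ i < s, p i = p' i) :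
    step e p m s = step e p' m s := by
  have : (List.range s).map p = (List.range s).map p' :=
    List.map_congr_left fun i hi => h i (List.mem_range.1 hi)
  simp only [step, this]

/-- A computation that halts at stage `s` has only ever seen the first `s` oracle symbols. -/
theorem exists_use {e : Code} {p : ℕ → ℕ} {m v : ℕ} (h : v ∈ run e p m) :
    ∃ N, ∀ p' : ℕ → ℕ, (∀ i < N, p i = p' i) → v ∈ run e p' m := by
  obtain ⟨s, hs, hlt⟩ := mem_run_iff.1 h
  refine ⟨s, fun p' hp' => mem_run_iff.2 ⟨s, ?_, fun s' hs' => ?_⟩⟩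
  · rwa [← step_congr hp']
  · rw [← step_congr fun i hi => hp' i (hi.trans hs')]
    exact hlt s' hs'

theorem mem_machine_iff {e : Code} {p r : ℕ → ℕ} :
    r ∈ machine e p ↔ ∀ m, r m ∈ run e p m := by
  constructor
  · rintro ⟨hd, rfl⟩ m
    exact Part.get_mem (hd m)
  · intro h
    exact ⟨fun m => Part.dom_iff_mem.2 ⟨_, h m⟩,
      funext fun m => Part.get_eq_of_mem (h m) (Part.dom_iff_mem.2 ⟨_, h m⟩)⟩

theorem exists_uniform_use {e : Code} {p r : ℕ → ℕ} (h : r ∈ machine e p) (T : ℕ) :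
    ∃ N, ∀ p' : ℕ → ℕ, (∀ i < N, p i = p' i) → ∀ m < T, r m ∈ run e p' m := by
  choose N hN using fun m => exists_use (mem_machine_iff.1 h m)
  refine ⟨(Finset.range T).sup N, fun p' hp' m hm => hN m p' fun i hi => hp' i ?_⟩
  exact hi.trans_le (Finset.le_sup (Finset.mem_range.2 hm))

/-- The machine that reads until `G` is nonzero on the prefix read so far, and then outputs the
predecessor of that value. -/
theorem exists_machine {G : List ℕ → ℕ → ℕ} (hG : Computable₂ G) :
    ∃ n, ∀ p r : ℕ → ℕ, (∀ m, ∃ s, G ((List.range s).map p) m = r m + 1 ∧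
      ∀ s' < s, G ((List.range s').map p) m = 0) → r ∈ machine (program n) p := by
  have hP : Nat.Partrec fun k =>
      Part.bind (Encodable.decode (α := List ℕ × ℕ) k) fun a =>
        ((fun a => Part.some (G a.1 a.2) : List ℕ × ℕ →. ℕ) a).map Encodable.encode := hG
  obtain ⟨e, he⟩ := Code.exists_code.1 hP
  refine ⟨encode e, fun p r h => mem_machine_iff.2 fun m => mem_run_iff.2 ?_⟩
  have hprog : program (encode e) = e := by simp [program]
  have hstep : ∀ s, step e p m s = Part.some (G ((List.range s).map p) m) := by
    intro s
    simp [step, he]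
  obtain ⟨s, hs, hlt⟩ := h m
  refine ⟨s, ?_, fun s' hs' => ?_⟩
  · rw [hprog, hstep, hs]
    exact Part.mem_some _
  · rw [hprog, hstep, hlt s' hs']
    exact Part.mem_some _

/-- The run of the program `e` on oracle tape `o` and input `i`, with at most `s` symbols of the
tape read and fuel `k` for each stage: `none` if the fuel does not suffice, `some 0` if the machine
asks for more symbols, `some (v + 1)` if it has halted with output `v`. -/
def boundedRun (e : Code) (k : ℕ) (o : ℕ → ℕ) (i : ℕ) : ℕ → Option ℕ
  | 0 => some 0
  | s + 1 => (boundedRun e k o i s).bind fun v =>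
      if v = 0 then e.evaln k (encode ((List.range s).map o, i)) else some v

/-- The sum of the outputs on the inputs below `t`, as far as they are found with fuel `k`. -/
def boundedSum (e : Code) (k : ℕ) (o : ℕ → ℕ) : ℕ → Option ℕ
  | 0 => some 0
  | t + 1 => (boundedSum e k o t).bind fun a => (boundedRun e k o t k).bind fun v =>
      if v = 0 then none else some (a + (v - 1))

theorem boundedRun_congr {e : Code} {k i : ℕ} {o o' : ℕ → ℕ} {s : ℕ} (h : ∀ j < s, o j = o' j) :
    boundedRun e k o i s = boundedRun e k o' i s := by
  induction s with
  | zero => rfl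
  | succ s ih =>
    have : (List.range s).map o = (List.range s).map o' :=
      List.map_congr_left fun j hj => h j ((List.mem_range.1 hj).trans s.lt_succ_self)
    simp only [boundedRun, ih fun j hj => h j (hj.trans s.lt_succ_self), this]

/-- The fuel `k` also caps the number of tape symbols read. This is what later makes a search stage
a function of a finite prefix. -/
theorem boundedSum_congr {e : Code} {k : ℕ} {o o' : ℕ → ℕ} (t : ℕ) (h : ∀ j < k, o j = o' j) :
    boundedSum e k o t = boundedSum e k o' t := by
  induction t with
  | zero => rfl
  | succ t ih => simp only [boundedSum, ih, boundedRun_congr h]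

theorem boundedRun_zero {e : Code} {k i : ℕ} {o : ℕ → ℕ} {s : ℕ}
    (h : boundedRun e k o i s = some 0) : ∀ s' < s, 0 ∈ step e o i s' := by
  induction s with
  | zero => simp
  | succ s ih =>
    obtain ⟨v, hv, hv'⟩ := Option.bind_eq_some_iff.1 h
    split_ifs at hv' with h0
    · subst h0
      intro s' hs'
      rcases Nat.lt_succ_iff_lt_or_eq.1 hs' with h1 | rfl
      · exact ih hv s' h1
      · exact Code.evaln_sound hv'
    · exact absurd (Option.some_inj.1 hv') h0

theorem boundedRun_sound {e : Code} {k i v : ℕ} {o : ℕ → ℕ} {s : ℕ}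
    (h : boundedRun e k o i s = some (v + 1)) : v ∈ run e o i := by
  induction s with
  | zero => simp [boundedRun] at h
  | succ s ih =>
    obtain ⟨w, hw, hw'⟩ := Option.bind_eq_some_iff.1 h
    split_ifs at hw' with h0
    · subst h0
      exact mem_run_iff.2 ⟨s, Code.evaln_sound hw', boundedRun_zero hw⟩
    · exact ih (hw.trans hw')

/-- Only finitely many stages precede halting, so one fuel serves them all by monotonicity of
`evaln`; after halting, the value is merely carried along. -/
theorem boundedRun_complete {e : Code} {i v : ℕ} {o : ℕ → ℕ} (h : v ∈ run e o i) :
    ∃ K, ∀ k ≥ K, ∀ s ≥ K, boundedRun e k o i s = some (v + 1) := by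
  obtain ⟨s₀, hs, hlt⟩ := mem_run_iff.1 h
  have hzero : ∀ s ≤ s₀, ∃ K, ∀ k ≥ K, boundedRun e k o i s = some 0 := by
    intro s hs
    induction s with
    | zero => exact ⟨0, fun _ _ => rfl⟩
    | succ s ih =>
      obtain ⟨K, hK⟩ := ih (by omega)
      obtain ⟨K', hK'⟩ := Code.evaln_complete.1 (hlt s (by omega))
      refine ⟨max K K', fun k hk => ?_⟩
      simp only [boundedRun, hK k (le_of_max_le_left hk), Option.bind_some, if_true]
      exact Code.evaln_mono (le_of_max_le_right hk) hK'
  obtain ⟨K, hK⟩ := hzero s₀ le_rfl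
  obtain ⟨K', hK'⟩ := Code.evaln_complete.1 hs
  -- `boundedRun` at `s` inspects the stages strictly below `s`, so the halting stage `s₀` is first
  -- seen at `s₀ + 1`.
  refine ⟨max (max K K') (s₀ + 1), fun k hk s hs => ?_⟩
  have hk' : max K K' ≤ k := le_of_max_le_left hk
  replace hs : s₀ + 1 ≤ s := le_of_max_le_right hs
  induction s, hs using Nat.le_induction with
  | base =>
    simp only [boundedRun, hK k (le_of_max_le_left hk'), Option.bind_some, if_true]
    exact Code.evaln_mono (le_of_max_le_right hk') hK'
  | succ s _ ih => simp [boundedRun, ih]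

theorem boundedSum_sound {e : Code} {k t a : ℕ} {o r : ℕ → ℕ} (hr : r ∈ machine e o)
    (h : boundedSum e k o t = some a) : a = ∑ i ∈ Finset.range t, r i := by
  induction t generalizing a with
  | zero => simpa [boundedSum, eq_comm] using h
  | succ t ih =>
    obtain ⟨b, hb, h⟩ := Option.bind_eq_some_iff.1 h
    obtain ⟨v, hv, h⟩ := Option.bind_eq_some_iff.1 h
    split_ifs at h with h0
    obtain ⟨w, rfl⟩ := Nat.exists_eq_succ_of_ne_zero h0
    have hw := Part.mem_unique (boundedRun_sound hv) (mem_machine_iff.1 hr t)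
    rw [Finset.sum_range_succ, ← ih hb, ← Option.some_inj.1 h, ← hw]
    rfl

theorem boundedSum_complete {e : Code} {o r : ℕ → ℕ} (hr : r ∈ machine e o) (t : ℕ) :
    ∃ K, ∀ k ≥ K, boundedSum e k o t = some (∑ i ∈ Finset.range t, r i) := by
  induction t with
  | zero => exact ⟨0, fun _ _ => rfl⟩
  | succ t ih =>
    obtain ⟨K, hK⟩ := ih
    obtain ⟨K', hK'⟩ := boundedRun_complete (mem_machine_iff.1 hr t)
    refine ⟨max K K', fun k hk => ?_⟩
    have hk' := le_of_max_le_right hk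
    simp [boundedSum, hK k (le_of_max_le_left hk), hK' k hk' k hk', Finset.sum_range_succ]

/-! ### Primitive recursiveness of the bounded simulation -/

variable {α : Type*} [Primcodable α]

theorem primrec_map_range {s : α → ℕ} {o : α → ℕ → ℕ} (hs : Primrec s) (ho : Primrec₂ o) :
    Primrec fun a => (List.range (s a)).map (o a) :=
  Primrec.list_map (Primrec.list_range.comp hs) ho

theorem primrec_boundedRun {e : α → Code} {k i s : α → ℕ} {o : α → ℕ → ℕ} (he : Primrec e)
    (hk : Primrec k) (ho : Primrec₂ o) (hi : Primrec i) (hs : Primrec s) :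
    Primrec fun a => boundedRun (e a) (k a) (o a) (i a) (s a) := by
  have hstep : Primrec₂ fun (x : α × ℕ × Option ℕ) (v : ℕ) =>
      if v = 0 then (e x.1).evaln (k x.1) (encode ((List.range x.2.1).map (o x.1), i x.1))
      else some v := by
    have h1 : Primrec fun y : (α × ℕ × Option ℕ) × ℕ => y.1.1 := Primrec.fst.comp Primrec.fst
    have h2 : Primrec fun y : (α × ℕ × Option ℕ) × ℕ => y.1.2.1 :=
      Primrec.fst.comp (Primrec.snd.comp Primrec.fst)
    have h3 : Primrec₂ fun (y : (α × ℕ × Option ℕ) × ℕ) (n : ℕ) => o y.1.1 n :=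
      ho.comp (h1.comp Primrec.fst) Primrec.snd
    refine Primrec.ite (Primrec.eq.comp Primrec.snd (Primrec.const 0)) ?_
      (Primrec.option_some.comp Primrec.snd)
    exact Code.primrec_evaln.comp (Primrec.pair (Primrec.pair (hk.comp h1) (he.comp h1))
      (Primrec.encode.comp (Primrec.pair (primrec_map_range h2 h3) (hi.comp h1))))
  have hrec : Primrec₂ fun (a : α) (x : ℕ × Option ℕ) => x.2.bind fun v =>
      if v = 0 then (e a).evaln (k a) (encode ((List.range x.1).map (o a), i a)) else some v :=
    Primrec.option_bind (Primrec.snd.comp Primrec.snd) hstep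
  refine (Primrec.nat_rec' hs (Primrec.const (some 0)) hrec).of_eq fun a => ?_
  induction s a with
  | zero => rfl
  | succ n ih => simp only [boundedRun, ← ih]

theorem primrec_boundedSum {e : α → Code} {k t : α → ℕ} {o : α → ℕ → ℕ} (he : Primrec e)
    (hk : Primrec k) (ho : Primrec₂ o) (ht : Primrec t) :
    Primrec fun a => boundedSum (e a) (k a) (o a) (t a) := by
  have hrun : Primrec fun x : (α × ℕ × Option ℕ) × ℕ =>
      boundedRun (e x.1.1) (k x.1.1) (o x.1.1) x.1.2.1 (k x.1.1) := by
    have h1 : Primrec fun y : (α × ℕ × Option ℕ) × ℕ => y.1.1 := Primrec.fst.comp Primrec.fst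
    exact primrec_boundedRun (o := fun y => o y.1.1) (he.comp h1) (hk.comp h1)
      (ho.comp (h1.comp Primrec.fst) Primrec.snd)
      (Primrec.fst.comp (Primrec.snd.comp Primrec.fst)) (hk.comp h1)
  have hadd : Primrec₂ fun (x : (α × ℕ × Option ℕ) × ℕ) (v : ℕ) =>
      if v = 0 then none else some (x.2 + (v - 1)) :=
    Primrec.ite (Primrec.eq.comp Primrec.snd (Primrec.const 0)) (Primrec.const none)
      (Primrec.option_some.comp (Primrec.nat_add.comp (Primrec.snd.comp Primrec.fst)
        (Primrec.pred.comp Primrec.snd)))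
  have hrec : Primrec₂ fun (a : α) (x : ℕ × Option ℕ) => x.2.bind fun b =>
      (boundedRun (e a) (k a) (o a) x.1 (k a)).bind fun v =>
        if v = 0 then none else some (b + (v - 1)) :=
    Primrec.option_bind (Primrec.snd.comp Primrec.snd) (Primrec.option_bind hrun hadd).to₂
  refine (Primrec.nat_rec' ht (Primrec.const (some 0)) hrec).of_eq fun a => ?_
  induction t a with
  | zero => rfl
  | succ n ih => simp only [boundedSum, ← ih]

end TypeTwo

open TypeTwo RepresentedSpace

/-! ### Recognising colours from finite information -/

theorem sum_block (m l : ℕ) {r : ℕ → ℕ} (h : ∀ i, r i = if m ≤ i ∧ i < m + (l + 1) then 1 else 0)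
    (t : ℕ) : ∑ i ∈ Finset.range t, r i = min (t - m) (l + 1) := by
  induction t with
  | zero => simp
  | succ t ih =>
    rw [Finset.sum_range_succ, ih, h]
    split_ifs <;> omega

/-- Two equal consecutive partial sums of a name determine the colour, if they are nonzero. -/
theorem colour_of_sum {k : ℕ} {r : ℕ → ℕ} {c : Option (Fin k)} (h : (colours k).IsName r c)
    {t : ℕ} (h0 : ∑ i ∈ Finset.range t, r i ≠ 0)
    (h1 : ∑ i ∈ Finset.range t, r i = ∑ i ∈ Finset.range (t + 1), r i) :
    ∃ l, c = some l ∧ ∑ i ∈ Finset.range t, r i = l.1 + 1 := by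
  rcases c with _ | l
  · have h : ∀ i, r i = 0 := h
    simp [h] at h0
  · obtain ⟨m, hm⟩ : ∃ m, ∀ i, r i = if m ≤ i ∧ i < m + (l.1 + 1) then 1 else 0 := h
    refine ⟨l, rfl, ?_⟩
    rw [sum_block m l.1 hm] at h0 h1 ⊢
    rw [sum_block m l.1 hm] at h1
    -- The sums are `min (t - m) (l + 1)`. Being nonzero gives `t > m`, and not growing from `t` to
    -- `t + 1` then forces `t - m ≥ l + 1`.
    omega

theorem sum_of_colour {k : ℕ} {r : ℕ → ℕ} {l : Fin k} (h : (colours k).IsName r (some l)) :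
    ∃ T, ∀ t ≥ T, ∑ i ∈ Finset.range t, r i = l.1 + 1 := by
  obtain ⟨m, hm⟩ : ∃ m, ∀ i, r i = if m ≤ i ∧ i < m + (l.1 + 1) then 1 else 0 := h
  refine ⟨m + (l.1 + 1), fun t ht => ?_⟩
  rw [sum_block m l.1 hm]
  omega

namespace ComputableMetric

variable {X : Type*} [MetricSpace X] (M : ComputableMetric X)

theorem space_isName_const (j : ℕ) : M.space.IsName (fun _ => j) (M.point j) := fun n => by
  rw [dist_self]
  positivity

variable {M}

/-- Strictness is an open condition: any finite prefix of such a name is also a prefix of a name of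
every sufficiently close point. -/
theorem exists_strict_name (y : X) : ∃ w : ℕ → ℕ, ∀ n, dist (M.point (w n)) y < (1 / 2) ^ n := by
  have h : ∀ n : ℕ, ∃ i, dist (M.point i) y < (1 / 2) ^ n := fun n => by
    obtain ⟨i, hi⟩ := M.dense.exists_dist_lt y (ε := (1 / 2) ^ n) (by positivity)
    exact ⟨i, by rwa [dist_comm]⟩
  exact ⟨_, fun n => (h n).choose_spec⟩

/-- Classifiers are locally constant where they are not `⊥`. -/
theorem eventually_eq_colour {k n : ℕ} {q : ℕ → ℕ} {f : X → Option (Fin k)}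
    (hf : Realizes M.space (colours k) (machineWithOracle n q) (f : X →. Option (Fin k)))
    {y : X} {l : Fin k} (hy : f y = some l) : ∀ᶠ z in nhds y, f z = some l := by
  obtain ⟨w, hw⟩ := exists_strict_name (M := M) y
  obtain ⟨r, hr, hrn⟩ := hf w y (f y) (fun i => (hw i).le) (Part.mem_some _)
  rw [hy] at hrn
  obtain ⟨T, hT⟩ := sum_of_colour hrn
  -- Certifying the colour needs the sums of length `T` and `T + 1`, hence the outputs on all inputs
  -- below `T + 1`.
  obtain ⟨N, hN⟩ := exists_uniform_use hr (T + 1)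
  have hnear : ∀ᶠ z in nhds y, ∀ i ∈ Finset.range N, dist (M.point (w i)) z < (1 / 2) ^ i := by
    refine (Finset.eventually_all _).2 fun i _ => ?_
    have hc : Continuous fun z => dist (M.point (w i)) z := by fun_prop
    exact hc.continuousAt.eventually (gt_mem_nhds (hw i))
  filter_upwards [hnear] with z hz
  obtain ⟨w', hw'⟩ := M.space.surjective z
  -- Splice the prefix of the name of `y` onto a name of `z`; the machine cannot distinguish the two
  -- on the relevant inputs.
  have hname : M.space.IsName (fun i => if i < N then w i else w' i) z := fun i => by
    dsimp only
    split_ifs with h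
    · exact (hz i (Finset.mem_range.2 h)).le
    · exact hw' i
  obtain ⟨r', hr', hrn'⟩ := hf _ z (f z) hname (Part.mem_some _)
  have heq : ∀ i < T + 1, r' i = r i := by
    intro i hi
    refine Part.mem_unique (mem_machine_iff.1 hr' i) (hN _ (fun j hj => ?_) i hi)
    have : j / 2 < N := by omega
    simp only [join, if_pos this]
  have hsum : ∀ t ≤ T + 1, ∑ i ∈ Finset.range t, r' i = ∑ i ∈ Finset.range t, r i := fun t ht =>
    Finset.sum_congr rfl fun i hi => heq i ((Finset.mem_range.1 hi).trans_le ht)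
  obtain ⟨l', hl', hs⟩ := colour_of_sum hrn' (t := T)
    (by rw [hsum T (by omega), hT T le_rfl]; omega)
    (by rw [hsum T (by omega), hsum (T + 1) le_rfl, hT T le_rfl, hT (T + 1) (by omega)])
  rw [hsum T (by omega), hT T le_rfl] at hs
  rw [hl']
  exact congrArg some (Fin.ext (by omega))

end ComputableMetric

/-! ### Arithmetic on the codes of rationals -/

/-- The order of the rationals, on their codes. -/
def CodeLE (a b : ℕ) : Prop :=
  a.unpair.1.unpair.1 * (b.unpair.2 + 1) + b.unpair.1.unpair.2 * (a.unpair.2 + 1) ≤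
    b.unpair.1.unpair.1 * (a.unpair.2 + 1) + a.unpair.1.unpair.2 * (b.unpair.2 + 1)

instance : DecidableRel CodeLE := fun _ _ => inferInstanceAs (Decidable (_ ≤ _))

/-- Cross-multiplying by the positive denominators and moving the subtracted parts to the other side
leaves an inequality of natural numbers. -/
theorem codeLE_iff (a b : ℕ) : CodeLE a b ↔ ratOfNat a ≤ ratOfNat b := by
  rw [ratOfNat, ratOfNat, div_le_div_iff₀ (by positivity) (by positivity), CodeLE,
    ← Nat.cast_le (α := ℚ)]
  push_cast
  constructor <;> intro h <;> linarith

theorem primrec_codeLE : PrimrecRel CodeLE := by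
  have h1 : Primrec fun n : ℕ => n.unpair.1.unpair.1 :=
    Primrec.fst.comp (Primrec.unpair.comp (Primrec.fst.comp Primrec.unpair))
  have h2 : Primrec fun n : ℕ => n.unpair.1.unpair.2 :=
    Primrec.snd.comp (Primrec.unpair.comp (Primrec.fst.comp Primrec.unpair))
  have h3 : Primrec fun n : ℕ => n.unpair.2 + 1 :=
    Primrec.succ.comp (Primrec.snd.comp Primrec.unpair)
  have ha {f : ℕ → ℕ} (hf : Primrec f) : Primrec fun x : ℕ × ℕ => f x.1 := hf.comp Primrec.fst
  have hb {f : ℕ → ℕ} (hf : Primrec f) : Primrec fun x : ℕ × ℕ => f x.2 := hf.comp Primrec.snd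
  exact Primrec.nat_le.comp
    (Primrec.nat_add.comp (Primrec.nat_mul.comp (ha h1) (hb h3))
      (Primrec.nat_mul.comp (hb h2) (ha h3)))
    (Primrec.nat_add.comp (Primrec.nat_mul.comp (hb h1) (ha h3))
      (Primrec.nat_mul.comp (ha h2) (hb h3)))

/-- The code of `a + 2 / (w + 1)`. -/
def addSlack (a w : ℕ) : ℕ :=
  Nat.pair (Nat.pair (a.unpair.1.unpair.1 * (w + 1) + 2 * (a.unpair.2 + 1))
    (a.unpair.1.unpair.2 * (w + 1))) ((a.unpair.2 + 1) * (w + 1) - 1)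

theorem ratOfNat_addSlack (a w : ℕ) : ratOfNat (addSlack a w) = ratOfNat a + 2 / (w + 1) := by
  have h : (((a.unpair.2 + 1) * (w + 1) - 1 : ℕ) : ℚ) + 1 = (a.unpair.2 + 1) * (w + 1) := by
    have : (a.unpair.2 + 1) * (w + 1) - 1 + 1 = (a.unpair.2 + 1) * (w + 1) :=
      Nat.sub_add_cancel (Nat.mul_pos (Nat.succ_pos _) (Nat.succ_pos _))
    exact_mod_cast this
  simp only [addSlack, ratOfNat, Nat.unpair_pair, h]
  push_cast
  field_simp
  ring

theorem primrec_addSlack : Primrec₂ addSlack := by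
  have h1 : Primrec fun x : ℕ × ℕ => x.1.unpair.1.unpair.1 :=
    Primrec.fst.comp (Primrec.unpair.comp (Primrec.fst.comp (Primrec.unpair.comp Primrec.fst)))
  have h2 : Primrec fun x : ℕ × ℕ => x.1.unpair.1.unpair.2 :=
    Primrec.snd.comp (Primrec.unpair.comp (Primrec.fst.comp (Primrec.unpair.comp Primrec.fst)))
  have h3 : Primrec fun x : ℕ × ℕ => x.1.unpair.2 + 1 :=
    Primrec.succ.comp (Primrec.snd.comp (Primrec.unpair.comp Primrec.fst))
  have hw : Primrec fun x : ℕ × ℕ => x.2 + 1 := Primrec.succ.comp Primrec.snd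
  exact Primrec₂.natPair.comp (Primrec₂.natPair.comp
    (Primrec.nat_add.comp (Primrec.nat_mul.comp h1 hw)
      (Primrec.nat_mul.comp (Primrec.const 2) h3)) (Primrec.nat_mul.comp h2 hw))
    (Primrec.pred.comp (Primrec.nat_mul.comp h3 hw))

/-- The minimum of extended rationals, on their codes. -/
def codeMin (a b : ℕ) : ℕ :=
  if a = 0 then b else if b = 0 then a else if CodeLE (a - 1) (b - 1) then a else b

theorem extRatOfNat_codeMin (a b : ℕ) :
    extRatOfNat (codeMin a b) = min (extRatOfNat a) (extRatOfNat b) := by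
  rcases a with _ | a
  · simp [codeMin, extRatOfNat]
  rcases b with _ | b
  · simp [codeMin, extRatOfNat]
  by_cases h : CodeLE a b
  · have h' : extRatOfNat (a + 1) ≤ extRatOfNat (b + 1) := by
      simpa [extRatOfNat] using (codeLE_iff a b).1 h
    simp [codeMin, h, min_eq_left h']
  · have h' : extRatOfNat (b + 1) ≤ extRatOfNat (a + 1) := by
      simpa [extRatOfNat] using (lt_of_not_ge fun h' => h ((codeLE_iff a b).2 h')).le
    simp [codeMin, h, min_eq_right h']

theorem codeMin_ne_zero_iff {a b : ℕ} : codeMin a b ≠ 0 ↔ a ≠ 0 ∨ b ≠ 0 := by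
  unfold codeMin
  split_ifs <;> simp_all

theorem primrec_codeMin : Primrec₂ codeMin :=
  Primrec.ite (Primrec.eq.comp Primrec.fst (Primrec.const 0)) Primrec.snd
    (Primrec.ite (Primrec.eq.comp Primrec.snd (Primrec.const 0)) Primrec.fst
      (Primrec.ite (primrec_codeLE.comp (Primrec.pred.comp Primrec.fst)
        (Primrec.pred.comp Primrec.snd)) Primrec.fst Primrec.snd))

/-! ### The search for differently coloured points of the dense sequence

The functions below act on a sequence `P = ⟨u, n q⟩`. Their stage `c = ⟨j, ⟨t, N⟩⟩` only looks at the
first `c` symbols of `P`. -/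

namespace TypeTwo

/-- If `P = ⟨u, n q⟩`, then this is `⟨q, u⟩`. -/
def inputOracle (P : ℕ → ℕ) (i : ℕ) : ℕ := if i % 2 = 0 then P (i + 3) else P (i - 1)

/-- If `P = ⟨u, n q⟩`, then this is `⟨q, j j j …⟩`. -/
def constOracle (P : ℕ → ℕ) (j i : ℕ) : ℕ := if i % 2 = 0 then P (i + 3) else j

theorem inputOracle_join (u q : ℕ → ℕ) (n : ℕ) :
    inputOracle (join u (cons n q)) = join q u := by
  funext i
  rcases Nat.even_or_odd' i with ⟨a, rfl | rfl⟩
  · have e1 : (2 * a + 3) % 2 = 1 := by omega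
    have e2 : (2 * a + 3) / 2 = a + 1 := by omega
    simp [inputOracle, join, e1, e2, cons]
  · have e1 : (2 * a + 1) % 2 = 1 := by omega
    have e2 : (2 * a + 1) / 2 = a := by omega
    simp [inputOracle, join, e1, e2]

theorem constOracle_join (u q : ℕ → ℕ) (n j : ℕ) :
    constOracle (join u (cons n q)) j = join q fun _ => j := by
  funext i
  rcases Nat.even_or_odd' i with ⟨a, rfl | rfl⟩
  · have e1 : (2 * a + 3) % 2 = 1 := by omega
    have e2 : (2 * a + 3) / 2 = a + 1 := by omega
    simp [constOracle, join, e1, e2, cons]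
  · have e1 : (2 * a + 1) % 2 = 1 := by omega
    simp [constOracle, join, e1]

/-- The `t`-th partial sum of the output of the machine named in `P`, or `0` if it is not found with
the fuel of stage `c`. -/
def stageSum (P o : ℕ → ℕ) (c t : ℕ) : ℕ :=
  (boundedSum (program (P 1)) (c - 3) o t).getD 0

/-- Stage `c = ⟨j, ⟨t, N⟩⟩` recognises that the input point and the `j`-th point of the dense sequence
have different colours. -/
def Separates (P : ℕ → ℕ) (c : ℕ) : Prop :=
  (3 < c ∧ stageSum P (inputOracle P) c c.unpair.2.unpair.1 =
      stageSum P (inputOracle P) c (c.unpair.2.unpair.1 + 1) ∧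
    stageSum P (constOracle P c.unpair.1) c c.unpair.2.unpair.1 =
      stageSum P (constOracle P c.unpair.1) c (c.unpair.2.unpair.1 + 1)) ∧
  ¬ stageSum P (inputOracle P) c c.unpair.2.unpair.1 = 0 ∧
  ¬ stageSum P (constOracle P c.unpair.1) c c.unpair.2.unpair.1 = 0 ∧
  ¬ stageSum P (inputOracle P) c c.unpair.2.unpair.1 =
      stageSum P (constOracle P c.unpair.1) c c.unpair.2.unpair.1

instance (P : ℕ → ℕ) (c : ℕ) : Decidable (Separates P c) :=
  inferInstanceAs (Decidable (_ ∧ _))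

/-- The code of the upper bound for the distance between the input point and the `j`-th point which
is found in stage `c`, or `0` if nothing is found. -/
def stageBound (g : ℕ × ℕ × ℕ → ℕ) (P : ℕ → ℕ) (c : ℕ) : ℕ :=
  if Separates P c then
    addSlack (g (P (2 * ((c - 3) / 2)), c.unpair.1, (c - 3) / 2)) ((c - 3) / 2) + 1
  else 0

/-- The code of the least upper bound found before stage `c`. -/
def bestBound (g : ℕ × ℕ × ℕ → ℕ) (P : ℕ → ℕ) : ℕ → ℕ
  | 0 => 0
  | c + 1 => codeMin (bestBound g P c) (stageBound g P c)

theorem stageSum_congr {P P' o o' : ℕ → ℕ} {c t : ℕ} (h1 : P 1 = P' 1)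
    (h : ∀ i < c - 3, o i = o' i) : stageSum P o c t = stageSum P' o' c t := by
  rw [stageSum, stageSum, h1, boundedSum_congr t h]

/-- Entry `i` of either oracle uses `P` at no position beyond `i + 3`, which explains the fuel `c -
3`. The guard `3 < c` also places `P 1` (the program) and `P (2 * ((c - 3) / 2))` (the approximation
of the input point) within the prefix. -/
theorem stageBound_congr {g : ℕ × ℕ × ℕ → ℕ} {P P' : ℕ → ℕ} {c : ℕ} (h : ∀ i < c, P i = P' i) :
    stageBound g P c = stageBound g P' c := by
  by_cases hc : 3 < c
  · have h1 := h 1 (by omega)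
    have hi : ∀ i < c - 3, inputOracle P i = inputOracle P' i := fun i hi => by
      rw [inputOracle, inputOracle, h (i + 3) (by omega), h (i - 1) (by omega)]
    have hk : ∀ i < c - 3, constOracle P c.unpair.1 i = constOracle P' c.unpair.1 i :=
      fun i hi => by rw [constOracle, constOracle, h (i + 3) (by omega)]
    have hS : Separates P c ↔ Separates P' c := by
      simp only [Separates, stageSum_congr h1 hi, stageSum_congr h1 hk]
    simp only [stageBound, hS, h (2 * ((c - 3) / 2)) (by omega)]
  · have hs : ∀ Q, ¬ Separates Q c := fun Q hQ => hc hQ.1.1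
    simp only [stageBound, if_neg (hs _)]

theorem bestBound_congr {g : ℕ × ℕ × ℕ → ℕ} {P P' : ℕ → ℕ} {c : ℕ} (h : ∀ i < c, P i = P' i) :
    bestBound g P c = bestBound g P' c := by
  induction c with
  | zero => rfl
  | succ c ih =>
    have h' : ∀ i < c, P i = P' i := fun i hi => h i (hi.trans c.lt_succ_self)
    rw [bestBound, bestBound, ih h', stageBound_congr h']

/-- `bestBound`, computed from a finite prefix. -/
def prefixBound (g : ℕ × ℕ × ℕ → ℕ) (l : List ℕ) : ℕ :=
  bestBound g (fun i => l.getD i 0) l.length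

/-- The zeros padding the list are harmless, since the first `s` stages never look beyond position
`s`. -/
theorem prefixBound_map (g : ℕ × ℕ × ℕ → ℕ) (P : ℕ → ℕ) (s : ℕ) :
    prefixBound g ((List.range s).map P) = bestBound g P s := by
  rw [prefixBound, List.length_map, List.length_range]
  exact bestBound_congr fun i hi => by simp [List.getD, hi]

/-! ### Computability of the search -/

theorem primrec_stageSum {o : List ℕ × ℕ → ℕ → ℕ} {t : List ℕ × ℕ → ℕ} (ho : Primrec₂ o)
    (ht : Primrec t) :
    Primrec fun x : List ℕ × ℕ => stageSum (fun i => x.1.getD i 0) (o x) x.2 (t x) := by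
  have he : Primrec fun x : List ℕ × ℕ => program (x.1.getD 1 0) :=
    (Primrec.ofNat _).comp ((Primrec.list_getD 0).comp Primrec.fst (Primrec.const 1))
  exact Primrec.option_getD.comp (primrec_boundedSum he
    (Primrec.nat_sub.comp Primrec.snd (Primrec.const 3)) ho ht) (Primrec.const 0)

theorem primrecPred_separates :
    PrimrecPred fun x : List ℕ × ℕ => Separates (fun i => x.1.getD i 0) x.2 := by
  have heven : PrimrecPred fun y : (List ℕ × ℕ) × ℕ => y.2 % 2 = 0 :=
    Primrec.eq.comp (Primrec.nat_mod.comp Primrec.snd (Primrec.const 2)) (Primrec.const 0)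
  have hq : Primrec fun y : (List ℕ × ℕ) × ℕ => y.1.1.getD (y.2 + 3) 0 :=
    (Primrec.list_getD 0).comp (Primrec.fst.comp Primrec.fst)
      (Primrec.nat_add.comp Primrec.snd (Primrec.const 3))
  have hu : Primrec fun y : (List ℕ × ℕ) × ℕ => y.1.1.getD (y.2 - 1) 0 :=
    (Primrec.list_getD 0).comp (Primrec.fst.comp Primrec.fst) (Primrec.pred.comp Primrec.snd)
  have hj : Primrec fun x : List ℕ × ℕ => x.2.unpair.1 :=
    Primrec.fst.comp (Primrec.unpair.comp Primrec.snd)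
  have ht : Primrec fun x : List ℕ × ℕ => x.2.unpair.2.unpair.1 :=
    Primrec.fst.comp (Primrec.unpair.comp (Primrec.snd.comp (Primrec.unpair.comp Primrec.snd)))
  have hin : Primrec₂ fun (x : List ℕ × ℕ) i => inputOracle (fun i => x.1.getD i 0) i :=
    Primrec.ite heven hq hu
  have hco : Primrec₂ fun (x : List ℕ × ℕ) i => constOracle (fun i => x.1.getD i 0) x.2.unpair.1 i :=
    Primrec.ite heven hq (hj.comp Primrec.fst)
  have hx := primrec_stageSum hin ht
  have hx' := primrec_stageSum hin (Primrec.succ.comp ht)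
  have hy := primrec_stageSum hco ht
  have hy' := primrec_stageSum hco (Primrec.succ.comp ht)
  exact ((Primrec.nat_lt.comp (Primrec.const 3) Primrec.snd).and
    ((Primrec.eq.comp hx hx').and (Primrec.eq.comp hy hy'))).and
    ((Primrec.eq.comp hx (Primrec.const 0)).not.and
      ((Primrec.eq.comp hy (Primrec.const 0)).not.and (Primrec.eq.comp hx hy).not))

/-- The metric approximation `g` is only assumed computable, so primitive recursiveness ends here.
-/
theorem computable_stageBound {g : ℕ × ℕ × ℕ → ℕ} (hg : Computable g) :
    Computable fun x : List ℕ × ℕ => stageBound g (fun i => x.1.getD i 0) x.2 := by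
  have hw : Primrec fun x : List ℕ × ℕ => (x.2 - 3) / 2 :=
    Primrec.nat_div.comp (Primrec.nat_sub.comp Primrec.snd (Primrec.const 3)) (Primrec.const 2)
  have hj : Primrec fun x : List ℕ × ℕ => x.2.unpair.1 :=
    Primrec.fst.comp (Primrec.unpair.comp Primrec.snd)
  have hu : Primrec fun x : List ℕ × ℕ => x.1.getD (2 * ((x.2 - 3) / 2)) 0 :=
    (Primrec.list_getD 0).comp Primrec.fst (Primrec.nat_mul.comp (Primrec.const 2) hw)
  have hb : Computable fun x : List ℕ × ℕ => addSlack
      (g (x.1.getD (2 * ((x.2 - 3) / 2)) 0, x.2.unpair.1, (x.2 - 3) / 2)) ((x.2 - 3) / 2) + 1 :=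
    Computable.succ.comp (primrec_addSlack.to_comp.comp
      (hg.comp (Computable.pair hu.to_comp (Computable.pair hj.to_comp hw.to_comp))) hw.to_comp)
  refine (Computable.cond primrecPred_separates.decide.to_comp hb (Computable.const 0)).of_eq
    fun x => ?_
  simp only [stageBound, Bool.cond_decide]

theorem computable_prefixBound {g : ℕ × ℕ × ℕ → ℕ} (hg : Computable g) :
    Computable (prefixBound g) := by
  have hstep : Computable₂ fun (l : List ℕ) (x : ℕ × ℕ) =>
      codeMin x.2 (stageBound g (fun i => l.getD i 0) x.1) :=
    primrec_codeMin.to_comp.comp (Computable.snd.comp Computable.snd)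
      ((computable_stageBound hg).comp
        (Computable.pair Computable.fst (Computable.fst.comp Computable.snd)))
  refine (Computable.nat_rec Computable.list_length (Computable.const 0) hstep).of_eq fun l => ?_
  rw [prefixBound]
  induction l.length with
  | zero => rfl
  | succ n ih => simp only [bestBound, ← ih]

end TypeTwo

/-! ### Soundness and completeness of the search stages -/

namespace TypeTwo

/-- A nonzero value cannot be the default `0` of an unfinished computation. -/
theorem stageSum_sound {P o r : ℕ → ℕ} {c t : ℕ} (hr : r ∈ machine (program (P 1)) o)
    (h : stageSum P o c t ≠ 0) : stageSum P o c t = ∑ i ∈ Finset.range t, r i := by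
  unfold stageSum at h ⊢
  rcases hs : boundedSum (program (P 1)) (c - 3) o t with _ | a
  · simp [hs] at h
  · exact boundedSum_sound hr hs

theorem stageSum_complete {P o r : ℕ → ℕ} (hr : r ∈ machine (program (P 1)) o) (t : ℕ) :
    ∃ K, ∀ c ≥ K, stageSum P o c t = ∑ i ∈ Finset.range t, r i := by
  obtain ⟨K, hK⟩ := boundedSum_complete hr t
  exact ⟨K + 3, fun c hc => by rw [stageSum, hK (c - 3) (by omega), Option.getD_some]⟩

end TypeTwo

namespace ComputableMetric

variable {X : Type*} [MetricSpace X] {M : ComputableMetric X} {k n : ℕ} {u q : ℕ → ℕ}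
  {f : X → Option (Fin k)} {x : X}

theorem exists_colour_output
    (hf : Realizes M.space (colours k) (machineWithOracle n q) (f : X →. Option (Fin k)))
    (hu : M.space.IsName u x) :
    ∃ r ∈ machine (program n) (inputOracle (join u (cons n q))), (colours k).IsName r (f x) := by
  rw [inputOracle_join]
  exact hf u x (f x) hu (Part.mem_some _)

theorem exists_colour_output_point
    (hf : Realizes M.space (colours k) (machineWithOracle n q) (f : X →. Option (Fin k))) (j : ℕ) :
    ∃ r ∈ machine (program n) (constOracle (join u (cons n q)) j),
      (colours k).IsName r (f (M.point j)) := by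
  rw [constOracle_join]
  exact hf _ _ _ (M.space_isName_const j) (Part.mem_some _)

theorem separates_sound
    (hf : Realizes M.space (colours k) (machineWithOracle n q) (f : X →. Option (Fin k)))
    (hu : M.space.IsName u x) {c : ℕ} (h : Separates (join u (cons n q)) c) :
    f x ≠ none ∧ f x ≠ f (M.point c.unpair.1) ∧ f (M.point c.unpair.1) ≠ none := by
  obtain ⟨r, hr, hrx⟩ := exists_colour_output hf hu
  obtain ⟨r', hr', hry⟩ := exists_colour_output_point (u := u) hf c.unpair.1
  obtain ⟨⟨-, hx, hy⟩, hx0, hy0, hxy⟩ := h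
  have e1 := stageSum_sound hr hx0
  -- The sum at `t + 1` equals the nonzero sum at `t`, so it too is genuine and not a default value.
  have e2 := stageSum_sound hr fun h => hx0 (hx.trans h)
  have e3 := stageSum_sound hr' hy0
  have e4 := stageSum_sound hr' fun h => hy0 (hy.trans h)
  rw [e1] at hx hx0 hxy
  rw [e2] at hx
  rw [e3] at hy hy0 hxy
  rw [e4] at hy
  obtain ⟨l, hl, hls⟩ := colour_of_sum hrx hx0 hx
  obtain ⟨l', hl', hls'⟩ := colour_of_sum hry hy0 hy
  rw [hl, hl']
  refine ⟨Option.some_ne_none _, fun h => hxy ?_, Option.some_ne_none _⟩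
  rw [hls, hls', Option.some_inj.1 h]

/-- Past some `t` both sums have stabilised, and more fuel does no harm. Having all large `N`,
rather than one, allows the precision of the distance bound to be raised for fixed `j` and `t`. -/
theorem separates_complete
    (hf : Realizes M.space (colours k) (machineWithOracle n q) (f : X →. Option (Fin k)))
    (hu : M.space.IsName u x) {j : ℕ} (hx : f x ≠ none) (hxy : f x ≠ f (M.point j))
    (hy : f (M.point j) ≠ none) :
    ∃ t K, ∀ N ≥ K, Separates (join u (cons n q)) (Nat.pair j (Nat.pair t N)) := by
  obtain ⟨l, hl⟩ := Option.ne_none_iff_exists'.1 hx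
  obtain ⟨l', hl'⟩ := Option.ne_none_iff_exists'.1 hy
  obtain ⟨r, hr, hrx⟩ := exists_colour_output hf hu
  obtain ⟨r', hr', hry⟩ := exists_colour_output_point (u := u) hf j
  rw [hl] at hrx hxy
  rw [hl'] at hry hxy
  have hne : l.1 ≠ l'.1 := fun h => hxy (congrArg some (Fin.ext h))
  obtain ⟨T, hT⟩ := sum_of_colour hrx
  obtain ⟨T', hT'⟩ := sum_of_colour hry
  obtain ⟨t, ht⟩ : ∃ t, max T T' = t := ⟨_, rfl⟩
  have h1 : T ≤ t := ht ▸ le_max_left _ _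
  have h2 : T' ≤ t := ht ▸ le_max_right _ _
  obtain ⟨K₁, hK₁⟩ := stageSum_complete (P := join u (cons n q)) hr t
  obtain ⟨K₂, hK₂⟩ := stageSum_complete (P := join u (cons n q)) hr (t + 1)
  obtain ⟨K₃, hK₃⟩ := stageSum_complete (P := join u (cons n q)) hr' t
  obtain ⟨K₄, hK₄⟩ := stageSum_complete (P := join u (cons n q)) hr' (t + 1)
  -- The stage number is at least `N`, so it exceeds every fuel threshold, and the `4` secures the
  -- guard `3 < c`.
  refine ⟨t, K₁ + K₂ + K₃ + K₄ + 4, fun N hN => ?_⟩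
  have hc : N ≤ Nat.pair j (Nat.pair t N) :=
    (Nat.right_le_pair _ _).trans (Nat.right_le_pair _ _)
  have hcj : (Nat.pair j (Nat.pair t N)).unpair.1 = j := by simp
  have hct : (Nat.pair j (Nat.pair t N)).unpair.2.unpair.1 = t := by simp
  rw [Separates, hcj, hct, hK₁ _ (by omega), hK₂ _ (by omega), hK₃ _ (by omega),
    hK₄ _ (by omega), hT t h1, hT (t + 1) (by omega), hT' t h2, hT' (t + 1) (by omega)]
  omega

/-! ### Distance bounds -/

variable {g : ℕ × ℕ × ℕ → ℕ}

theorem half_pow_le (w : ℕ) : ((1 : ℝ) / 2) ^ w ≤ 1 / (w + 1) := by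
  rw [one_div_pow]
  refine one_div_le_one_div_of_le (by positivity) ?_
  exact_mod_cast Nat.lt_two_pow_self (n := w)

/-- The name of `x` and the approximation `g` each err by at most `2^(-w) ≤ 1/(w + 1)`. Adding `2/(w
+ 1)` makes the estimate an upper bound, which then overshoots by at most `4/(w + 1)`. -/
theorem addSlack_bounds
    (hg : ∀ i j n, |(ratOfNat (g (i, j, n)) : ℝ) - dist (M.point i) (M.point j)| ≤ (1 / 2) ^ n)
    (hu : M.space.IsName u x) (j w : ℕ) :
    dist x (M.point j) ≤ ratOfNat (addSlack (g (u w, j, w)) w) ∧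
      (ratOfNat (addSlack (g (u w, j, w)) w) : ℝ) ≤ dist x (M.point j) + 4 * (1 / (w + 1)) := by
  have h1 := abs_le.1 (hg (u w) j w)
  have h2 : dist (M.point (u w)) x ≤ (1 / 2) ^ w := hu w
  have h3 := half_pow_le w
  have h4 := dist_triangle_left x (M.point j) (M.point (u w))
  have h5 := dist_triangle (M.point (u w)) x (M.point j)
  have h6 : (2 : ℝ) / (w + 1) = 2 * (1 / (w + 1)) := by ring
  rw [ratOfNat_addSlack]
  push_cast
  rw [h6]
  constructor <;> linarith

theorem stageBound_eq {c : ℕ} (h : Separates (join u (cons n q)) c) :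
    stageBound g (join u (cons n q)) c =
      addSlack (g (u ((c - 3) / 2), c.unpair.1, (c - 3) / 2)) ((c - 3) / 2) + 1 := by
  have : join u (cons n q) (2 * ((c - 3) / 2)) = u ((c - 3) / 2) := by simp [join]
  rw [stageBound, if_pos h, this]

theorem stageBound_sound
    (hg : ∀ i j n, |(ratOfNat (g (i, j, n)) : ℝ) - dist (M.point i) (M.point j)| ≤ (1 / 2) ^ n)
    (hf : Realizes M.space (colours k) (machineWithOracle n q) (f : X →. Option (Fin k)))
    (hu : M.space.IsName u x) {c : ℕ} {r : ℝ}
    (hr : extRatOfNat (stageBound g (join u (cons n q)) c) < r) : r ∈ adversarialRadii x f := by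
  by_cases h : Separates (join u (cons n q)) c
  · rw [stageBound_eq h, extRatOfNat, EReal.coe_lt_coe_iff] at hr
    have hd := (addSlack_bounds hg hu c.unpair.1 ((c - 3) / 2)).1.trans_lt hr
    exact ⟨dist_nonneg.trans hd.le, _, by rwa [Metric.mem_ball, dist_comm],
      separates_sound hf hu h⟩
  · rw [stageBound, if_neg h] at hr
    exact absurd hr (not_lt_of_ge le_top)

theorem stageBound_complete
    (hg : ∀ i j n, |(ratOfNat (g (i, j, n)) : ℝ) - dist (M.point i) (M.point j)| ≤ (1 / 2) ^ n)
    (hf : Realizes M.space (colours k) (machineWithOracle n q) (f : X →. Option (Fin k)))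
    (hu : M.space.IsName u x) {r : ℝ} (hr : r ∈ adversarialRadii x f) :
    ∃ c, extRatOfNat (stageBound g (join u (cons n q)) c) < r := by
  obtain ⟨-, y, hyr, hx, hxy, hy⟩ := hr
  obtain ⟨l, hl⟩ := Option.ne_none_iff_exists'.1 hy
  -- Replace `y` by a dense point of the same colour that still lies in the open ball.
  obtain ⟨j, hj, hjr⟩ : ∃ j, f (M.point j) = some l ∧ M.point j ∈ Metric.ball x r := by
    have hev := (eventually_eq_colour hf hl).and (Metric.isOpen_ball.mem_nhds hyr)
    obtain ⟨V, hV, hVo, hyV⟩ := eventually_nhds_iff.1 hev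
    obtain ⟨j, hj⟩ := M.dense.exists_mem_open hVo ⟨y, hyV⟩
    exact ⟨j, hV _ hj⟩
  obtain ⟨t, K, hK⟩ := separates_complete hf hu (j := j) hx (by rw [hj, ← hl]; exact hxy)
    (by simp [hj])
  rw [Metric.mem_ball, dist_comm] at hjr
  obtain ⟨W, hW⟩ := exists_nat_one_div_lt (show (0 : ℝ) < (r - dist x (M.point j)) / 4 by linarith)
  -- With `c ≥ 2 * W + 3` the precision index `(c - 3) / 2` is at least `W`, so the overshoot is
  -- below `r - dist x (M.point j)`.
  obtain ⟨c, hc⟩ : ∃ c, c = Nat.pair j (Nat.pair t (K + 2 * W + 3)) := ⟨_, rfl⟩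
  have hcN : K + 2 * W + 3 ≤ c := hc ▸ (Nat.right_le_pair _ _).trans (Nat.right_le_pair _ _)
  have hS : Separates (join u (cons n q)) c := hc ▸ hK _ (by omega)
  have hcj : c.unpair.1 = j := by simp [hc]
  refine ⟨c, ?_⟩
  rw [stageBound_eq hS, extRatOfNat, EReal.coe_lt_coe_iff, hcj]
  refine (addSlack_bounds hg hu j ((c - 3) / 2)).2.trans_lt ?_
  have hWw : W ≤ (c - 3) / 2 := by omega
  have : (1 : ℝ) / (((c - 3) / 2 : ℕ) + 1) ≤ 1 / (W + 1) :=
    one_div_le_one_div_of_le (by positivity) (by exact_mod_cast Nat.succ_le_succ hWw)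
  linarith

/-! ### Convergence of the running minimum -/

theorem antitone_bestBound (P : ℕ → ℕ) : Antitone fun c => extRatOfNat (bestBound g P c) :=
  antitone_nat_of_succ_le fun c => by
    rw [bestBound, extRatOfNat_codeMin]
    exact min_le_left _ _

/-- The disjunct `⊤ < a`, never true, stands for the initial value `+∞` and lets the induction
start. -/
theorem bestBound_lt_iff {P : ℕ → ℕ} {c : ℕ} {a : EReal} :
    extRatOfNat (bestBound g P c) < a ↔
      (⊤ < a ∨ ∃ c' < c, extRatOfNat (stageBound g P c') < a) := by
  induction c with
  | zero => simp [bestBound, extRatOfNat]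
  | succ c ih =>
    rw [bestBound, extRatOfNat_codeMin, min_lt_iff, ih]
    simp only [Nat.lt_succ_iff_lt_or_eq, or_and_right, exists_or, exists_eq_left, or_assoc]

/-- A decreasing sequence converges to its infimum. The two infima agree because a real `r` above
some bound belongs to `R(x, f)`, and every element of `R(x, f)` lies strictly above some bound. -/
theorem tendsto_bestBound
    (hg : ∀ i j n, |(ratOfNat (g (i, j, n)) : ℝ) - dist (M.point i) (M.point j)| ≤ (1 / 2) ^ n)
    (hf : Realizes M.space (colours k) (machineWithOracle n q) (f : X →. Option (Fin k)))
    (hu : M.space.IsName u x) :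
    Filter.Tendsto (fun c => extRatOfNat (bestBound g (join u (cons n q)) c)) Filter.atTop
      (nhds (sInf ((fun r : ℝ => (r : EReal)) '' adversarialRadii x f))) := by
  have h := tendsto_atTop_iInf (antitone_bestBound (g := g) (join u (cons n q)))
  convert h using 2
  refine le_antisymm (le_iInf fun c => ?_) (le_sInf ?_)
  · refine EReal.le_of_forall_lt_iff_le.1 fun r hr => ?_
    obtain h | ⟨c', -, hc'⟩ := bestBound_lt_iff.1 hr
    · exact absurd h not_top_lt
    · exact sInf_le ⟨r, stageBound_sound hg hf hu hc', rfl⟩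
  · rintro _ ⟨r, hr, rfl⟩
    obtain ⟨c, hc⟩ := stageBound_complete hg hf hu hr
    exact (iInf_le _ (c + 1)).trans
      (bestBound_lt_iff.2 (Or.inr ⟨c, c.lt_succ_self, hc⟩)).le

theorem coe_sInf_adversarialRadii (h : (adversarialRadii x f).Nonempty) :
    ((sInf (adversarialRadii x f) : ℝ) : EReal) =
      sInf ((fun r : ℝ => (r : EReal)) '' adversarialRadii x f) := by
  have hb : BddBelow (adversarialRadii x f) := ⟨0, fun r hr => hr.1⟩
  refine le_antisymm (le_sInf ?_) (EReal.le_of_forall_lt_iff_le.1 fun a ha => ?_)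
  · rintro _ ⟨r, hr, rfl⟩
    exact EReal.coe_le_coe_iff.2 (csInf_le hb hr)
  · obtain ⟨r, hr, hra⟩ := (csInf_lt_iff hb h).1 (EReal.coe_lt_coe_iff.1 ha)
    exact (sInf_le (Set.mem_image_of_mem _ hr)).trans (EReal.coe_le_coe_iff.2 hra.le)

end ComputableMetric

/-! ### The two realizers -/

theorem proposition3p6 {X : Type*} [MetricSpace X] (M : ComputableMetric X) (k : ℕ) (hk : 0 < k) :
    RepresentedSpace.IsComputableMap
      (M.space.prod (M.space.functionSpace (RepresentedSpace.colours k))) extUpperReal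
      (fun z : X × M.Classifier k => Part.some
        (sInf ((fun r : ℝ => (r : EReal)) '' ComputableMetric.adversarialRadii z.1 z.2.1))) ∧
    RepresentedSpace.IsComputableMap
      (M.space.prod (M.space.functionSpace (RepresentedSpace.colours k))) upperReal
      (fun z : X × M.Classifier k =>
        ⟨(ComputableMetric.adversarialRadii z.1 z.2.1).Nonempty,
          fun _ => sInf (ComputableMetric.adversarialRadii z.1 z.2.1)⟩) := by
  obtain ⟨g, hgc, hg⟩ := M.dist_computable
  have hshort : PrimrecPred fun x : List ℕ × ℕ => x.1.length < x.2 :=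
    Primrec.nat_lt.comp (Primrec.list_length.comp Primrec.fst) Primrec.snd
  have hbound : Computable fun x : List ℕ × ℕ => prefixBound g x.1 :=
    (computable_prefixBound hgc).comp Computable.fst
  constructor
  · have hG : Computable₂ fun (l : List ℕ) (m : ℕ) =>
        bif decide (l.length < m) then 0 else prefixBound g l + 1 :=
      Computable.cond hshort.decide.to_comp (Computable.const 0) (Computable.succ.comp hbound)
    obtain ⟨e, he⟩ := exists_machine hG
    refine ⟨machine (program e), ⟨e, fun _ _ h => h⟩, ?_⟩
    rintro p ⟨x, f⟩ y ⟨u, v, rfl, hu, n, q, rfl, hf⟩ hy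
    rw [Part.mem_some_iff.1 hy]
    refine ⟨bestBound g (join u (cons n q)), he _ _ fun m => ⟨m, ?_, fun s hs => ?_⟩,
      ComputableMetric.antitone_bestBound _, ComputableMetric.tendsto_bestBound hg hf hu⟩
    · simp [prefixBound_map]
    · simp [hs]
  · have hG : Computable₂ fun (l : List ℕ) (m : ℕ) =>
        bif decide (l.length < m) then 0 else prefixBound g l :=
      Computable.cond hshort.decide.to_comp (Computable.const 0) hbound
    obtain ⟨e, he⟩ := exists_machine hG
    refine ⟨machine (program e), ⟨e, fun _ _ h => h⟩, ?_⟩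
    rintro p ⟨x, f⟩ y ⟨u, v, rfl, hu, n, q, rfl, hf⟩ ⟨hne, hy⟩
    have hne : (ComputableMetric.adversarialRadii x f.1).Nonempty := hne
    have hy : sInf (ComputableMetric.adversarialRadii x f.1) = y := hy
    subst hy
    set P := join u (cons n q) with hP
    have hanti := ComputableMetric.antitone_bestBound (g := g) P
    have hex : ∃ c, bestBound g P c ≠ 0 := by
      obtain ⟨r, hr⟩ := hne
      obtain ⟨c, hc⟩ := ComputableMetric.stageBound_complete hg hf hu hr
      refine ⟨c + 1, fun h0 => ?_⟩
      have := ComputableMetric.bestBound_lt_iff.2 (Or.inr ⟨c, c.lt_succ_self, hc⟩)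
      rw [h0] at this
      exact not_top_lt this
    have hpos : ∀ c, Nat.find hex ≤ c → bestBound g P c ≠ 0 := fun c hc => by
      induction c, hc using Nat.le_induction with
      | base => exact Nat.find_spec hex
      | succ c _ ih => exact codeMin_ne_zero_iff.2 (Or.inl ih)
    have hval : ∀ m, extRatOfNat (bestBound g P (max m (Nat.find hex))) =
        ((ratOfNat (bestBound g P (max m (Nat.find hex)) - 1) : ℝ) : EReal) := fun m => by
      obtain ⟨b, hb⟩ := Nat.exists_eq_succ_of_ne_zero (hpos _ (le_max_right m _))
      rw [hb]
      rfl
    -- On input `m` the machine halts once `m` symbols are read and a finite bound is known, so the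
    -- output sequence is `bestBound` reindexed by `max m (Nat.find hex)`, with the same limit.
    refine ⟨fun m => bestBound g P (max m (Nat.find hex)) - 1,
      he _ _ fun m => ⟨max m (Nat.find hex), ?_, fun s hs => ?_⟩, fun m m' hm => ?_, ?_⟩
    · have h0 := hpos _ (le_max_right m _)
      simp only [List.length_map, List.length_range, prefixBound_map]
      rw [decide_eq_false (not_lt_of_ge (le_max_left _ _)), cond_false]
      omega
    · simp only [List.length_map, List.length_range, prefixBound_map]
      rcases lt_max_iff.1 hs with h | h
      · simp [h]
      · have := Nat.find_min hex h
        simp_all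
    · have := hanti (max_le_max_right (Nat.find hex) hm)
      simp only [hval] at this
      exact EReal.coe_le_coe_iff.1 this
    · refine EReal.tendsto_coe.1 ?_
      rw [ComputableMetric.coe_sInf_adversarialRadii hne]
      simp only [← hval]
      refine (ComputableMetric.tendsto_bestBound hg hf hu).comp ?_
      exact Filter.tendsto_atTop_mono (fun m => le_max_left m _) Filter.tendsto_id
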